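/- Let $V$ be a vector space of finite dimension $\ell\ge 2$ over a field $\mathbb{K}$, let $S=\mathrm{Sym}(V^*)\cong\mathbb{K}[x_1,\dots,x_\ell]$, and let $\mathcal{A}$ be a central hyperplane arrangement in $V$, i.e. a finite set of linear hyperplanes $L=\ker\alpha_L$ with $0\ne\alpha_L\in V^*$. Put $D(\mathcal{A})=\{\theta\in\mathrm{Der}_{\mathbb{K}}(S)\mid \theta(\alpha_L)\in S\alpha_L \text{ for all } L\in\mathcal{A}\}$. A derivation $\theta$ is homogeneous of degree $n$ if $\theta(\alpha)$ is a homogeneous polynomial of degree $n$ (or $0$) for every $\alpha\in V^*$. The arrangement $\mathcal{A}$ is free with exponents $\exp(\mathcal{A})=(d_1,\dots,d_\ell)$ if $D(\mathcal{A})$ has an $S$-basis $\theta_1,\dots,\theta_\ell$ with $\theta_i$ homogeneous of degree $d_i$, and it is free if it is so for some exponents. For $H\in\mathcal{A}$ let $\mathcal{A}\setminus\{H\}$ be the deletion and $\mathcal{A}^H=\{L\cap H\mid L\in\mathcal{A}\setminus\{H\}\}$ the restriction, an arrangement in $H$ with coordinate ring $\mathrm{Sym}(H^*)\cong S/\alpha_HS$,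 and let $\rho^H:D(\mathcal{A})\to D(\mathcal{A}^H)$, $\rho^H(\theta)(\overline f)=\overline{\theta(f)}$, be the Euler restriction map, where $\overline f$ is the restriction of $f\in S$ to $H$. **Theorem.** Let $H\in\mathcal{A}$. Suppose that $\mathcal{A}$ and $\mathcal{A}^H$ are free with $\exp(\mathcal{A})=(d_1,\dots,d_\ell)$ and $\exp(\mathcal{A}^H)=(e_1,\dots,e_{\ell-1})$, where $1=d_1\le d_2\le\dots\le d_\ell$ and $1=e_1\le e_2\le\dots\le e_{\ell-1}$, and that $\mathcal{A}\setminus\{H\}$ is not free. Then one of the following holds. (i) $e_j\le d_j$ for all $1\le j\le\ell-1$. (ii) There is $k$ with $3\le k\le\ell-1$ such that $e_j\le d_j$ for all $j\le k-1$, $d_k<e_k$, and $e_i=d_{i+1}$ for all $k\le i\le\ell-1$. Moreover, for all homogeneous bases $\theta_1,\dots,\theta_\ell$ of $D(\mathcal{A})$ with $\deg\theta_i=d_i$ and $\varphi_1,\dots,\varphi_{\ell-1}$ of $D(\mathcal{A}^H)$ with $\deg\varphi_i=e_i$, the elements $\varphi_i$ with $i\ge k$ can be replaced so that $\rho^H(\theta_{i+1})=\varphi_i$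 for all $k\le i\le\ell-1$; that is, $\varphi_1,\dots,\varphi_{k-1},\rho^H(\theta_{k+1}),\dots,\rho^H(\theta_\ell)$ is again a homogeneous basis of $D(\mathcal{A}^H)$, with degrees $e_1,\dots,e_{\ell-1}$. -/

import Mathlib

noncomputable section

namespace HypArr

universe u v

section Basic

variable (K : Type u) [Field K] (V : Type v) [AddCommGroup V] [Module K V]

/-- A central hyperplane arrangement in `V`: a finite set of linear hyperplanes,
each of which is the kernel of a nonzero linear form. -/
@[ext]
structure Arrangement where
  hyperplanes : Set (Submodule K V)
  finite_hyperplanes : hyperplanes.Finite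
  exists_form : ∀ H ∈ hyperplanes, ∃ α : Module.Dual K V, α ≠ 0 ∧ LinearMap.ker α = H

/-- The coordinate ring `S = Sym(V*)`, a polynomial ring in `dim V` variables. -/
abbrev CoordRing := SymmetricAlgebra K (Module.Dual K V)

/-- A linear form on `V`, regarded as an element of `S = Sym(V*)`. -/
abbrev linForm : Module.Dual K V →ₗ[K] CoordRing K V :=
  SymmetricAlgebra.ι K (Module.Dual K V)

/-- The `K`-linear derivations of `S`. -/
abbrev Der := Derivation K (CoordRing K V) (CoordRing K V)

/-- The homogeneous polynomials of degree `n`: the span in `S` of the products of `n`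
linear forms. -/
def homogeneousPart (n : ℕ) : Submodule K (CoordRing K V) :=
  LinearMap.range (linForm K V) ^ n

end Basic

variable {K : Type u} [Field K] {V : Type v} [AddCommGroup V] [Module K V]

/-- `θ` is homogeneous of (polynomial) degree `n`: it sends every linear form to a homogeneous
polynomial of degree `n`. -/
def IsHomogeneousDer (θ : Der K V) (n : ℕ) : Prop :=
  ∀ α : Module.Dual K V, θ (linForm K V α) ∈ homogeneousPart K V n

/-- The restriction of polynomial functions from `V` to a subspace `H`, that is, the algebra
homomorphism `Sym(V*) → Sym(H*)` induced by `V* → H*`. -/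
def res (H : Submodule K V) : CoordRing K V →ₐ[K] CoordRing K H :=
  SymmetricAlgebra.lift (linForm K H ∘ₗ H.subtype.dualMap)

@[simp]
theorem res_linForm (H : Submodule K V) (α : Module.Dual K V) :
    res H (linForm K V α) = linForm K H (H.subtype.dualMap α) := by
  simp [res]

theorem res_surjective (H : Submodule K V) : Function.Surjective (res H) := by
  intro x
  induction x using SymmetricAlgebra.induction with
  | algebraMap r => exact ⟨algebraMap K _ r, AlgHom.commutes _ r⟩
  | ι β =>
    obtain ⟨α, rfl⟩ := LinearMap.dualMap_surjective_of_injective H.injective_subtype β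
    exact ⟨linForm K V α, res_linForm H α⟩
  | mul a b ha hb =>
    obtain ⟨x, rfl⟩ := ha
    obtain ⟨y, rfl⟩ := hb
    exact ⟨x * y, map_mul _ x y⟩
  | add a b ha hb =>
    obtain ⟨x, rfl⟩ := ha
    obtain ⟨y, rfl⟩ := hb
    exact ⟨x + y, map_add _ x y⟩

/-- A linear form vanishing on the kernel of `α` is a scalar multiple of `α`. -/
theorem exists_smul_of_ker_le {W : Type*} [AddCommGroup W] [Module K W]
    {α β : Module.Dual K W} (h : LinearMap.ker α ≤ LinearMap.ker β) : ∃ c : K, β = c • α := by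
  have := mem_span_of_iInf_ker_le_ker (L := fun _ : Unit => α) (K := β) (by simpa using h)
  simp only [Set.range_const, Submodule.mem_span_singleton] at this
  obtain ⟨c, hc⟩ := this
  exact ⟨c, hc.symm⟩

/-- The polynomials vanishing on the hyperplane `ker α` are the multiples of `α`. -/
theorem mem_span_of_res_eq_zero {H : Submodule K V} {α : Module.Dual K V}
    (hα : LinearMap.ker α = H) {f : CoordRing K V} (hf : res H f = 0) :
    f ∈ Ideal.span {linForm K V α} := by
  obtain ⟨s, hs⟩ := LinearMap.exists_rightInverse_of_surjective (H.subtype.dualMap)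
    (LinearMap.range_eq_top.2 (LinearMap.dualMap_surjective_of_injective H.injective_subtype))
  let I : Ideal (CoordRing K V) := Ideal.span {linForm K V α}
  let σ : CoordRing K H →ₐ[K] CoordRing K V := SymmetricAlgebra.lift (linForm K V ∘ₗ s)
  have key : ((Ideal.Quotient.mkₐ K I).comp σ).comp (res H) = Ideal.Quotient.mkₐ K I := by
    apply SymmetricAlgebra.algHom_ext
    ext γ
    have h1 : σ (res H (linForm K V γ)) = linForm K V (s (H.subtype.dualMap γ)) := by
      simp [σ]
    change Ideal.Quotient.mkₐ K I (σ (res H (linForm K V γ)))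
      = Ideal.Quotient.mkₐ K I (linForm K V γ)
    rw [h1]
    simp only [Ideal.Quotient.mkₐ_eq_mk]
    rw [Ideal.Quotient.eq, ← map_sub]
    have h2 : H.subtype.dualMap (s (H.subtype.dualMap γ) - γ) = 0 := by
      rw [map_sub, sub_eq_zero]
      exact LinearMap.congr_fun hs _
    obtain ⟨c, hc⟩ := exists_smul_of_ker_le (α := α) (β := s (H.subtype.dualMap γ) - γ) (by
      intro x hx
      rw [hα] at hx
      exact LinearMap.congr_fun h2 ⟨x, hx⟩)
    rw [hc, map_smul]
    exact Submodule.smul_of_tower_mem I c (Ideal.subset_span rfl)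
  have h3 := AlgHom.congr_fun key f
  rw [AlgHom.comp_apply, hf, map_zero] at h3
  exact Ideal.Quotient.eq_zero_iff_mem.1 h3.symm

theorem res_linForm_eq_zero {H : Submodule K V} {α : Module.Dual K V}
    (hα : LinearMap.ker α = H) : res H (linForm K V α) = 0 := by
  have : H.subtype.dualMap α = 0 := by
    ext x
    have hx : (x : V) ∈ LinearMap.ker α := hα ▸ x.2
    exact hx
  rw [res_linForm, this, map_zero]

namespace Arrangement

/-- The logarithmic derivation module
`D(A) = {θ ∈ Der S | θ(α_H) ∈ S α_H for all H ∈ A}`. The condition does not depend on the choice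
of the linear form `α_H` with kernel `H`, so it is imposed for every such form. -/
def logDer (A : Arrangement K V) : Submodule (CoordRing K V) (Der K V) where
  carrier := {θ | ∀ H ∈ A.hyperplanes, ∀ α : Module.Dual K V, LinearMap.ker α = H →
    θ (linForm K V α) ∈ Ideal.span {linForm K V α}}
  zero_mem' := fun _ _ _ _ => Ideal.zero_mem _
  add_mem' := fun hθ hη H hH α hα => Ideal.add_mem _ (hθ H hH α hα) (hη H hH α hα)
  smul_mem' := fun f _ hθ H hH α hα => Ideal.mul_mem_left _ f (hθ H hH α hα)

/-- The family `θ` of members of `D(A)` is a homogeneous `S`-basis of `D(A)` with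
`deg θ i = d i`. -/
def IsHomogeneousBasis (A : Arrangement K V) {n : ℕ} (d : Fin n → ℕ)
    (θ : Fin n → A.logDer) : Prop :=
  LinearIndependent (CoordRing K V) θ ∧ Submodule.span (CoordRing K V) (Set.range θ) = ⊤ ∧
    ∀ i, IsHomogeneousDer (θ i : Der K V) (d i)

/-- `A` is free with exponents `d 0, …, d (n-1)`. -/
def IsFreeWithExp (A : Arrangement K V) {n : ℕ} (d : Fin n → ℕ) : Prop :=
  ∃ θ : Fin n → A.logDer, A.IsHomogeneousBasis d θ

/-- `A` is free: `D(A)` has a homogeneous basis consisting of `dim V` derivations. -/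
def IsFree (A : Arrangement K V) : Prop :=
  ∃ d : Fin (Module.finrank K V) → ℕ, A.IsFreeWithExp d

/-- The deletion `A' = A ∖ {H}`. -/
def deletion (A : Arrangement K V) (H : Submodule K V) : Arrangement K V where
  hyperplanes := A.hyperplanes \ {H}
  finite_hyperplanes := A.finite_hyperplanes.sdiff
  exists_form := fun L hL => A.exists_form L hL.1

/-- The kernel of a nonzero form that contains the kernel of a form is equal to it. -/
theorem ker_eq_of_ker_le {α β : Module.Dual K V} (hβ : β ≠ 0)
    (h : LinearMap.ker α ≤ LinearMap.ker β) : LinearMap.ker α = LinearMap.ker β := by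
  obtain ⟨c, rfl⟩ := exists_smul_of_ker_le h
  have hc : c ≠ 0 := by
    rintro rfl
    simp at hβ
  exact (LinearMap.ker_smul α c hc).symm

/-- The restriction `A^H = {L ∩ H | L ∈ A ∖ {H}}`, an arrangement in the vector space `H`. -/
def restriction (A : Arrangement K V) (H : Submodule K V) (hH : H ∈ A.hyperplanes) :
    Arrangement K H where
  hyperplanes := (fun L : Submodule K V => L.comap H.subtype) '' (A.deletion H).hyperplanes
  finite_hyperplanes := (A.deletion H).finite_hyperplanes.image _
  exists_form := by
    rintro _ ⟨L, hL, rfl⟩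
    obtain ⟨α, -, hα⟩ := A.exists_form H hH
    obtain ⟨β, hβ0, hβ⟩ := A.exists_form L hL.1
    refine ⟨H.subtype.dualMap β, ?_, ?_⟩
    · intro h0
      apply hL.2
      rw [Set.mem_singleton_iff, ← hα, ← hβ]
      refine (ker_eq_of_ker_le hβ0 fun x hx => ?_).symm
      rw [hα] at hx
      exact LinearMap.congr_fun h0 ⟨x, hx⟩
    · ext x
      simp [← hβ]

/-- A derivation in `D(A)` preserves the ideal of polynomials that vanish on `H ∈ A`. -/
theorem res_der_eq_zero (A : Arrangement K V) (H : Submodule K V) (hH : H ∈ A.hyperplanes)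
    (θ : A.logDer) (f : CoordRing K V) (hf : res H f = 0) :
    res H ((θ : Der K V) f) = 0 := by
  obtain ⟨α, -, hα⟩ := A.exists_form H hH
  obtain ⟨g, rfl⟩ := Ideal.mem_span_singleton'.1 (mem_span_of_res_eq_zero hα hf)
  obtain ⟨h, hh⟩ := Ideal.mem_span_singleton'.1 (θ.2 H hH α hα)
  rw [Derivation.leibniz, ← hh]
  simp only [smul_eq_mul, map_add, map_mul, res_linForm_eq_zero hα, mul_zero, zero_mul, add_zero]

/-- The Euler restriction map `ρ^H : D(A) → D(A^H)`, characterized by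
`ρ^H(θ)(f|_H) = θ(f)|_H` for all polynomials `f` on `V`. -/
def eulerRestriction (A : Arrangement K V) (H : Submodule K V) (hH : H ∈ A.hyperplanes)
    (θ : A.logDer) : (A.restriction H hH).logDer :=
  ⟨Derivation.liftOfSurjective (res_surjective H) (A.res_der_eq_zero H hH θ), by
    rintro _ ⟨L, hL, rfl⟩ γ hγ
    obtain ⟨β, hβ0, hβ⟩ := A.exists_form L hL.1
    obtain ⟨c, hc⟩ := exists_smul_of_ker_le (α := H.subtype.dualMap β) (β := γ) (by
      rw [hγ]
      intro x hx
      simpa [← hβ] using hx)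
    have hL' : L ∈ A.hyperplanes := hL.1
    by_cases hc0 : c = 0
    · rw [hc, hc0, zero_smul, map_zero, map_zero]
      exact Ideal.zero_mem _
    have hker : LinearMap.ker (c • β) = L := by
      rw [LinearMap.ker_smul β c hc0, hβ]
    have hγ' : linForm K H γ = res H (linForm K V (c • β)) := by
      rw [res_linForm, hc, map_smul H.subtype.dualMap]
    rw [hγ', Derivation.liftOfSurjective_apply]
    obtain ⟨g, hg⟩ := Ideal.mem_span_singleton'.1 (θ.2 L hL' (c • β) hker)
    rw [← hg, map_mul]
    exact Ideal.mul_mem_left _ _ (Ideal.subset_span rfl)⟩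

theorem eulerRestriction_res (A : Arrangement K V) (H : Submodule K V) (hH : H ∈ A.hyperplanes)
    (θ : A.logDer) (f : CoordRing K V) :
    (A.eulerRestriction H hH θ : Der K H) (res H f) = res H ((θ : Der K V) f) :=
  Derivation.liftOfSurjective_apply _ (A.res_der_eq_zero H hH θ) f

end Arrangement

end HypArr

end

/-!
Write `S = Sym(V*)`, `T = Sym(H*)` and `ρ : D(A) → D(A^H)` for the Euler restriction. Indices start
at `0`, as in the statement.

The argument rests on the fact that `ρ` is surjective in codimension one: for each prime `p` of `T`
there is `s` not divisible by `p` with `s D(A^H) ⊆ ρ(D(A))`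
(`exists_smul_mem_range_eulerRestriction`). Indeed, the forms `α_L` with `p ∣ α_L|_H` all restrict
to multiples of one form, hence are eigenvectors, with a common eigenvalue, of a suitable lift of a
given `φ ∈ D(A^H)`; multiplying this lift by the other `α_L` gives a member of `D(A)`. If now a
family `ψ` of `ℓ - 1` members of `D(A^H)` has a span containing `ρ(D(A))`, then the determinant of
`ψ` with respect to a basis divides a power of each such `s`, so no prime divides it: `ψ` is a
basis. When `ψ` is homogeneous, a term of this determinant with nonzero constant coefficient matches
the degrees of `ψ` with the exponents of `A^H`
(`isHomogeneousBasis_of_eulerRestriction_mem_span`).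

Assume that (i) fails and let `k` be minimal with `d_k < e_k`. For degree reasons `ρ(θ_i)` with
`i ≤ k` lies in the span of `φ_0, …, φ_{k-1}`. So `φ_0, …, φ_{k-1}, ρ(θ_{k+1}), …, ρ(θ_{ℓ-1})` has a
span containing `ρ(D(A))`, and the criterion gives both the equalities `e_i = d_{i+1}` and the basis
in (ii) (`exp_eq_and_isHomogeneousBasis_ite`).

Finally `k ≠ 0` since `d_0 = e_0`, and `k ≠ 1` since `A ∖ {H}` is not free: if `k = 1`, then
`ρ(θ_0) = c φ_0` with a constant `c` and `ρ(θ_1) = q φ_0`, so either `ρ(θ_0) = 0` or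
`ρ(θ_1 - u θ_0)` vanishes for some homogeneous `u`. A homogeneous basis of `D(A)` with one member `θ_b` in the kernel
of `ρ` yields a homogeneous basis of `D(A ∖ {H})`, obtained by dividing `θ_b` by `α_H`, because the
other members restrict to a basis of `D(A^H)` by the same criterion
(`deletion_isFreeWithExp_of_eulerRestriction_eq_zero`).
-/

noncomputable section

namespace HypArr

universe u v

variable {K : Type u} [Field K] {V : Type v} [AddCommGroup V] [Module K V]

/-! ### Linear forms and derivations of the coordinate ring -/

instance coordRing_uniqueFactorizationMonoid : UniqueFactorizationMonoid (CoordRing K V) :=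
  (SymmetricAlgebra.equivMvPolynomial
    (Module.Free.chooseBasis K (Module.Dual K V))).symm.toMulEquiv.uniqueFactorizationMonoid
      inferInstance

theorem linForm_injective : Function.Injective (linForm K V) := by
  intro a b h
  let F : CoordRing K V →ₐ[K] TrivSqZeroExt K (Module.Dual K V) :=
    SymmetricAlgebra.lift (TrivSqZeroExt.inrHom K (Module.Dual K V))
  have h' : F (linForm K V a) = F (linForm K V b) := by rw [h]
  exact TrivSqZeroExt.inr_injective (by simpa [F] using h')

theorem linForm_ne_zero {α : Module.Dual K V} (h : α ≠ 0) : linForm K V α ≠ 0 := by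
  rw [← map_zero (linForm K V)]
  exact linForm_injective.ne h

theorem res_eq_zero_iff_dvd {H : Submodule K V} {α : Module.Dual K V}
    (hα : LinearMap.ker α = H) {f : CoordRing K V} : res H f = 0 ↔ linForm K V α ∣ f := by
  refine ⟨fun h => Ideal.mem_span_singleton.1 (mem_span_of_res_eq_zero hα h), ?_⟩
  rintro ⟨g, rfl⟩
  rw [map_mul, res_linForm_eq_zero hα, zero_mul]

theorem res_linForm_eq_zero_iff {H : Submodule K V} {α : Module.Dual K V} :
    res H (linForm K V α) = 0 ↔ H ≤ LinearMap.ker α := by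
  rw [res_linForm, ← map_zero (linForm K H), linForm_injective.eq_iff]
  constructor
  · intro h x hx
    exact LinearMap.congr_fun h ⟨x, hx⟩
  · intro h
    ext x
    exact h x.2

theorem prime_linForm {α : Module.Dual K V} (h : α ≠ 0) : Prime (linForm K V α) := by
  refine ⟨linForm_ne_zero h, fun hu => ?_, fun a b hab => ?_⟩
  · have h1 : res (LinearMap.ker α) (linForm K V α) = 0 := res_linForm_eq_zero rfl
    have h2 := hu.map (res (LinearMap.ker α))
    rw [h1] at h2
    exact not_isUnit_zero h2
  · rw [← res_eq_zero_iff_dvd rfl, map_mul, mul_eq_zero] at hab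
    simpa only [res_eq_zero_iff_dvd rfl] using hab

theorem exists_smul_of_linForm_dvd {α β : Module.Dual K V}
    (h : linForm K V α ∣ linForm K V β) : ∃ c : K, β = c • α :=
  exists_smul_of_ker_le (res_linForm_eq_zero_iff.1 ((res_eq_zero_iff_dvd rfl).2 h))

/-- Two linear forms with a common prime factor are proportional. -/
theorem exists_smul_of_prime_dvd {α β : Module.Dual K V} (hα : α ≠ 0) {p : CoordRing K V}
    (hp : Prime p) (h₁ : p ∣ linForm K V α) (h₂ : p ∣ linForm K V β) : ∃ c : K, β = c • α :=
  exists_smul_of_linForm_dvd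
    ((hp.associated_of_dvd (prime_linForm hα) h₁).dvd_iff_dvd_left.1 h₂)

theorem der_ext {D₁ D₂ : Der K V} (h : ∀ α, D₁ (linForm K V α) = D₂ (linForm K V α)) :
    D₁ = D₂ := by
  ext f
  induction f using SymmetricAlgebra.induction with
  | algebraMap r => simp
  | ι x => exact h x
  | mul a b ha hb => rw [Derivation.leibniz, Derivation.leibniz, ha, hb]
  | add a b ha hb => rw [map_add, map_add, ha, hb]

/-- The derivation of `S` extending a linear map `V* → S`. It is read off from the algebra
homomorphism `α ↦ α + T(α) ε` into the dual numbers over `S`. -/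
def derOfLinear (T : Module.Dual K V →ₗ[K] CoordRing K V) : Der K V :=
  let F : CoordRing K V →ₐ[K] TrivSqZeroExt (CoordRing K V) (CoordRing K V) :=
    SymmetricAlgebra.lift ((TrivSqZeroExt.inlAlgHom K _ _).toLinearMap ∘ₗ linForm K V +
      (TrivSqZeroExt.inrHom (CoordRing K V) (CoordRing K V)).restrictScalars K ∘ₗ T)
  have hF : ∀ f, (F f).fst = f := by
    have : (TrivSqZeroExt.fstHom K _ _).comp F = AlgHom.id K _ := by
      apply SymmetricAlgebra.algHom_ext
      ext α
      simp [F]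
    exact fun f => AlgHom.congr_fun this f
  Derivation.mk'
    ((TrivSqZeroExt.sndHom (CoordRing K V) (CoordRing K V)).restrictScalars K ∘ₗ F.toLinearMap)
    (fun a b => by simp [TrivSqZeroExt.snd_mul, hF, mul_comm])

@[simp]
theorem derOfLinear_linForm (T : Module.Dual K V →ₗ[K] CoordRing K V) (α : Module.Dual K V) :
    derOfLinear T (linForm K V α) = T α := by
  simp [derOfLinear]

/-! ### The grading of the coordinate ring -/

open scoped DirectSum

/-- The linear forms, as elements of degree one of the direct sum of the homogeneous parts. -/
def gradedLinForm : Module.Dual K V →ₗ[K] ⨁ i : ℕ, homogeneousPart K V i :=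
  DirectSum.lof K ℕ (fun i => homogeneousPart K V i) 1 ∘ₗ
    (linForm K V).codRestrict _ fun m => by
      simpa only [homogeneousPart, pow_one] using LinearMap.mem_range_self _ m

instance homogeneousPart_gradedMonoid : SetLike.GradedMonoid (homogeneousPart K V) :=
  inferInstanceAs (SetLike.GradedMonoid (LinearMap.range (linForm K V) ^ ·))

/-- `S` is graded by its homogeneous parts. -/
instance homogeneousPart_gradedAlgebra : GradedAlgebra (homogeneousPart K V) :=
  GradedAlgebra.ofAlgHom _ (SymmetricAlgebra.lift gradedLinForm)
    (by
      apply SymmetricAlgebra.algHom_ext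
      ext m
      simp [gradedLinForm, DirectSum.lof_eq_of])
    fun i x => by
    obtain ⟨x, hx⟩ := x
    dsimp only [DirectSum.lof_eq_of]
    unfold homogeneousPart at hx
    induction hx using Submodule.pow_induction_on_left' with
    | algebraMap r =>
      rw [AlgHom.commutes, DirectSum.algebraMap_apply]; rfl
    | add x y i hx hy ihx ihy =>
      rw [map_add, ihx, ihy, ← map_add]
      rfl
    | mem_mul m hm i x hx ih =>
      obtain ⟨_, rfl⟩ := hm
      rw [map_mul, ih, SymmetricAlgebra.lift_ι_apply, gradedLinForm, LinearMap.comp_apply,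
        DirectSum.lof_eq_of, DirectSum.of_mul_of]
      exact DirectSum.of_eq_of_gradedMonoid_eq (Sigma.subtype_ext (add_comm _ _) rfl)

theorem linForm_mem (α : Module.Dual K V) : linForm K V α ∈ homogeneousPart K V 1 := by
  rw [homogeneousPart, pow_one]
  exact LinearMap.mem_range_self _ α

theorem mul_mem_homogeneousPart {a b : CoordRing K V} {i j : ℕ} (ha : a ∈ homogeneousPart K V i)
    (hb : b ∈ homogeneousPart K V j) : a * b ∈ homogeneousPart K V (i + j) :=
  SetLike.mul_mem_graded ha hb

theorem map_res_homogeneousPart (H : Submodule K V) (n : ℕ) :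
    (homogeneousPart K V n).map (res H).toLinearMap = homogeneousPart K H n := by
  rw [homogeneousPart, homogeneousPart, Submodule.map_pow]
  congr 1
  rw [← LinearMap.range_comp]
  have : (res H).toLinearMap ∘ₗ linForm K V = linForm K H ∘ₗ H.subtype.dualMap := by
    ext α
    exact res_linForm H α
  rw [this, LinearMap.range_comp_of_range_eq_top]
  exact LinearMap.range_eq_top.2
    (LinearMap.dualMap_surjective_of_injective H.injective_subtype)

/-- The quotient of a homogeneous polynomial by a linear form is homogeneous. -/
theorem mem_homogeneousPart_of_mul_mem {α : Module.Dual K V} (hα : α ≠ 0) {f : CoordRing K V}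
    {n : ℕ} (h : linForm K V α * f ∈ homogeneousPart K V (n + 1)) :
    f ∈ homogeneousPart K V n := by
  have key : linForm K V α * DirectSum.decompose (homogeneousPart K V) f n
      = linForm K V α * f := by
    rw [← DirectSum.decompose_of_mem_same _ h, mul_comm, mul_comm (linForm K V α) f,
      DirectSum.coe_decompose_mul_add_of_right_mem _ (linForm_mem α)]
  rw [← mul_left_cancel₀ (linForm_ne_zero hα) key]
  exact SetLike.coe_mem _

/-- The value of a polynomial at the origin. -/
abbrev constCoeff : CoordRing K V →ₐ[K] K := SymmetricAlgebra.algebraMapInv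

theorem constCoeff_eq_zero {f : CoordRing K V} {n : ℕ} (hf : f ∈ homogeneousPart K V (n + 1)) :
    constCoeff f = 0 := by
  rw [homogeneousPart, pow_succ] at hf
  induction hf using Submodule.mul_induction_on' with
  | mem_mul_mem a _ b hb =>
    obtain ⟨α, rfl⟩ := hb
    rw [map_mul, constCoeff, SymmetricAlgebra.algebraMapInv_ι, mul_zero]
  | add x _ y _ hx hy => rw [map_add, hx, hy, add_zero]

/-! ### Bases and divisibility -/

theorem isUnit_of_forall_prime {R : Type*} [CommRing R] [IsDomain R] [UniqueFactorizationMonoid R]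
    {a : R} (h : ∀ p : R, Prime p → ¬ p ∣ a) (h0 : a ≠ 0) : IsUnit a := by
  by_contra hu
  obtain ⟨p, hp, hpa⟩ := WfDvdMonoid.exists_irreducible_factor hu h0
  exact h p hp.prime hpa

/-- If for each prime `p` the span of `ψ` contains the free module with basis `b` up to a factor
`s` not divisible by `p`, then `ψ` is a basis. In matrix terms `N M = s`, so
`det M` divides a power of `s`. The hypothesis that some prime exists excludes the case of a field,
where the condition is void. -/
theorem isUnit_det_of_locally_spanning {R M ι : Type*} [CommRing R] [IsDomain R]
    [UniqueFactorizationMonoid R] [AddCommGroup M] [Module R M] [Fintype ι] [DecidableEq ι]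
    (b : Module.Basis ι R M) (ψ : ι → M)
    (hex : ∃ p : R, Prime p)
    (h : ∀ p : R, Prime p → ∃ s, ¬ p ∣ s ∧ ∀ j, s • b j ∈ Submodule.span R (Set.range ψ)) :
    IsUnit (b.det ψ) := by
  have key : ∀ s : R, (∀ j, s • b j ∈ Submodule.span R (Set.range ψ)) →
      b.det ψ ∣ s ^ Fintype.card ι := by
    intro s hs
    choose N hN using fun j => Submodule.mem_span_range_iff_exists_fun R |>.1 (hs j)
    refine ⟨(Matrix.of N).det, ?_⟩
    have hmul : Matrix.of N * (b.toMatrix ψ).transpose = s • (1 : Matrix ι ι R) := by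
      ext j l
      have := congrArg (fun x => b.repr x l) (hN j)
      simpa [Matrix.mul_apply, Module.Basis.toMatrix_apply, Finsupp.single_apply,
        Matrix.one_apply] using this
    have hdet := congrArg Matrix.det hmul
    rw [Matrix.det_mul, Matrix.det_transpose, Matrix.det_smul, Matrix.det_one, mul_one] at hdet
    rw [Module.Basis.det_apply, mul_comm, hdet]
  refine isUnit_of_forall_prime (fun p hp hpd => ?_) ?_
  · obtain ⟨s, hps, hs⟩ := h p hp
    exact hps (hp.dvd_of_dvd_pow (hpd.trans (key s hs)))
  · obtain ⟨p, hp⟩ := hex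
    obtain ⟨s, hps, hs⟩ := h p hp
    have hs0 : s ≠ 0 := fun h0 => hps (h0 ▸ dvd_zero p)
    exact ne_zero_of_dvd_ne_zero (pow_ne_zero _ hs0) (key s hs)

namespace Arrangement

variable {A : Arrangement K V}

theorem logDer_ext {θ η : A.logDer}
    (h : ∀ α, (θ : Der K V) (linForm K V α) = (η : Der K V) (linForm K V α)) : θ = η :=
  Subtype.ext (der_ext h)

/-! ### The Euler restriction map -/

section Restriction

variable {H : Submodule K V} (hH : H ∈ A.hyperplanes)

theorem eulerRestriction_add (θ η : A.logDer) :
    A.eulerRestriction H hH (θ + η) = A.eulerRestriction H hH θ + A.eulerRestriction H hH η := by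
  apply Subtype.ext
  ext x
  obtain ⟨f, rfl⟩ := res_surjective H x
  simp only [Submodule.coe_add, Derivation.add_apply, eulerRestriction_res, map_add]

theorem eulerRestriction_smul (f : CoordRing K V) (θ : A.logDer) :
    A.eulerRestriction H hH (f • θ) = res H f • A.eulerRestriction H hH θ := by
  apply Subtype.ext
  ext x
  obtain ⟨f, rfl⟩ := res_surjective H x
  simp only [Submodule.coe_smul, Derivation.smul_apply, eulerRestriction_res, smul_eq_mul, map_mul]

/-- The Euler restriction map as a semilinear map along `S → Sym(H*)`. -/
def eulerRestrictionₛₗ :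
    A.logDer →ₛₗ[(res H : CoordRing K V →+* CoordRing K H)] (A.restriction H hH).logDer where
  toFun := A.eulerRestriction H hH
  map_add' := eulerRestriction_add hH
  map_smul' := eulerRestriction_smul hH

theorem eulerRestriction_sum_smul {ι : Type*} (s : Finset ι) (f : ι → CoordRing K V)
    (θ : ι → A.logDer) :
    A.eulerRestriction H hH (∑ i ∈ s, f i • θ i)
      = ∑ i ∈ s, res H (f i) • A.eulerRestriction H hH (θ i) := by
  change eulerRestrictionₛₗ hH _ = _
  rw [map_sum]
  exact Finset.sum_congr rfl fun i _ => eulerRestriction_smul hH _ _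

theorem isHomogeneousDer_eulerRestriction {θ : A.logDer} {n : ℕ}
    (h : IsHomogeneousDer (θ : Der K V) n) :
    IsHomogeneousDer (A.eulerRestriction H hH θ : Der K H) n := by
  intro β
  obtain ⟨α, rfl⟩ := LinearMap.dualMap_surjective_of_injective H.injective_subtype β
  rw [← res_linForm, eulerRestriction_res, ← map_res_homogeneousPart]
  exact Submodule.mem_map_of_mem (h α)

theorem linForm_dvd_of_eulerRestriction_eq_zero {α : Module.Dual K V} (hα : LinearMap.ker α = H)
    {θ : A.logDer} (h : A.eulerRestriction H hH θ = 0) (f : CoordRing K V) :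
    linForm K V α ∣ (θ : Der K V) f := by
  rw [← res_eq_zero_iff_dvd hα, ← eulerRestriction_res A H hH, h]
  rfl

/-- The image of the Euler restriction map agrees with `D(A^H)` at every prime element of
`Sym(H*)`. -/
theorem exists_smul_mem_range_eulerRestriction {p : CoordRing K H} (hp : Prime p) :
    ∃ s : CoordRing K H, ¬ p ∣ s ∧ ∀ φ : (A.restriction H hH).logDer,
      ∃ η : A.logDer, A.eulerRestriction H hH η = s • φ := by
  classical
  choose! form form_ne form_ker using A.exists_form
  let bad : Finset (Submodule K V) :=
    (A.deletion H).finite_hyperplanes.toFinset.filter fun L =>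
      ¬ p ∣ res H (linForm K V (form L))
  have hbad : ∀ L, L ∈ bad ↔ (L ∈ A.hyperplanes ∧ L ≠ H) ∧
      ¬ p ∣ res H (linForm K V (form L)) := fun L => by simp [bad, deletion]
  let Q : CoordRing K V := ∏ L ∈ bad, linForm K V (form L)
  refine ⟨res H Q, ?_, fun φ => ?_⟩
  · rw [map_prod, hp.dvd_finsetProd_iff]
    rintro ⟨L, hL, h⟩
    exact ((hbad L).1 hL).2 h
  -- All hyperplanes `L ≠ H` with `p ∣ α_L` have the same trace on `H`, so they share one
  -- eigenvalue `g` of a suitable lift of `φ`.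
  obtain ⟨g, hg⟩ : ∃ g : CoordRing K V, ∀ L ∈ A.hyperplanes, L ≠ H →
      p ∣ res H (linForm K V (form L)) →
      (φ : Der K H) (res H (linForm K V (form L))) = res H g * res H (linForm K V (form L)) := by
    by_cases hex : ∃ L ∈ A.hyperplanes, L ≠ H ∧ p ∣ res H (linForm K V (form L))
    · obtain ⟨L₀, hL₀, hne₀, hp₀⟩ := hex
      have hmem : L₀.comap H.subtype ∈ (A.restriction H hH).hyperplanes := ⟨L₀, ⟨hL₀, hne₀⟩, rfl⟩
      have hker : LinearMap.ker (H.subtype.dualMap (form L₀)) = L₀.comap H.subtype := by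
        conv_rhs => rw [← form_ker L₀ hL₀]
        rfl
      obtain ⟨gb, hgb⟩ := Ideal.mem_span_singleton'.1 (φ.2 _ hmem _ hker)
      obtain ⟨g, rfl⟩ := res_surjective H gb
      refine ⟨g, fun L hL hne hpL => ?_⟩
      rw [res_linForm] at hp₀ hpL ⊢
      have h0 : H.subtype.dualMap (form L₀) ≠ 0 := by
        intro h0
        rw [h0, LinearMap.ker_zero] at hker
        apply hne₀
        have hle : H ≤ L₀ := fun x hx => by
          have : (⟨x, hx⟩ : H) ∈ L₀.comap H.subtype := hker ▸ Submodule.mem_top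
          exact this
        rw [← form_ker H hH, ← form_ker L₀ hL₀] at hle ⊢
        exact (ker_eq_of_ker_le (form_ne L₀ hL₀) hle).symm
      obtain ⟨c, hc⟩ := exists_smul_of_prime_dvd h0 hp hp₀ hpL
      rw [hc, map_smul, Derivation.map_smul, ← hgb, mul_smul_comm]
    · push Not at hex
      exact ⟨0, fun L hL hne hpL => absurd hpL (hex L hL hne)⟩
  obtain ⟨σ, hσ⟩ := LinearMap.exists_rightInverse_of_surjective (res H).toLinearMap
    (LinearMap.range_eq_top.2 (res_surjective H))
  have hσ' : ∀ x, res H (σ x) = x := fun x => LinearMap.congr_fun hσ x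
  -- `φ - g` on linear forms, which vanishes wherever `φ` has eigenvalue `g`.
  let Φ : Module.Dual K V →ₗ[K] CoordRing K H :=
    ((φ : Der K H) : CoordRing K H →ₗ[K] CoordRing K H) ∘ₗ (res H).toLinearMap ∘ₗ linForm K V
      - (LinearMap.mulLeft K (res H g)) ∘ₗ (res H).toLinearMap ∘ₗ linForm K V
  have hΦ : ∀ α, Φ α = (φ : Der K H) (res H (linForm K V α))
      - res H g * res H (linForm K V α) := fun α => rfl
  let θ : Der K V := derOfLinear (LinearMap.mulLeft K g ∘ₗ linForm K V + σ ∘ₗ Φ)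
  have hθ : ∀ α, θ (linForm K V α) = g * linForm K V α + σ (Φ α) := fun α => by simp [θ]
  have hQθ : Q • θ ∈ A.logDer := by
    intro L hL α hα
    obtain ⟨c, rfl⟩ := exists_smul_of_ker_le (α := form L) (β := α)
      (by rw [hα, form_ker L hL])
    have hc : c ≠ 0 := by
      rintro rfl
      rw [zero_smul, LinearMap.ker_zero] at hα
      apply form_ne L hL
      rw [← LinearMap.ker_eq_top, form_ker L hL, hα]
    rw [map_smul, Derivation.map_smul, Ideal.mem_span_singleton, Derivation.smul_apply,
      smul_eq_mul, hθ, Algebra.smul_def, Algebra.smul_def, ((isUnit_iff_ne_zero.2 hc).map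
        (algebraMap K (CoordRing K V))).mul_left_dvd]
    apply Dvd.dvd.mul_left
    by_cases hLbad : L ∈ bad
    · exact (Finset.dvd_prod_of_mem (fun L => linForm K V (form L)) hLbad).mul_right _
    apply Dvd.dvd.mul_left
    have h0 : Φ (form L) = 0 := by
      rw [hΦ]
      by_cases hLH : L = H
      · have : res H (linForm K V (form L)) = 0 :=
          res_linForm_eq_zero (by rw [hLH, form_ker H hH])
        rw [this, map_zero, mul_zero, sub_zero]
      · rw [hg L hL hLH, sub_self]
        by_contra hn
        exact hLbad ((hbad L).2 ⟨⟨hL, hLH⟩, hn⟩)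
    rw [h0, map_zero, add_zero]
    exact Dvd.intro_left g rfl
  refine ⟨⟨Q • θ, hQθ⟩, logDer_ext fun β => ?_⟩
  obtain ⟨α, rfl⟩ := LinearMap.dualMap_surjective_of_injective H.injective_subtype β
  rw [← res_linForm, eulerRestriction_res]
  simp only [Derivation.smul_apply, smul_eq_mul, map_mul, Submodule.coe_smul, hθ, map_add, hσ', hΦ]
  ring

end Restriction

/-! ### Homogeneous bases -/

theorem logDer_linearIndependent_iff {n : ℕ} {θ : Fin n → A.logDer} :
    LinearIndependent (CoordRing K V) θ ↔
      ∀ g : Fin n → CoordRing K V, ∑ i, g i • θ i = 0 → ∀ i, g i = 0 :=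
  Fintype.linearIndependent_iff (R := CoordRing K V) (M := A.logDer)

theorem mem_span_range_logDer_iff {n : ℕ} {θ : Fin n → A.logDer} {x : A.logDer} :
    x ∈ Submodule.span (CoordRing K V) (Set.range θ) ↔
      ∃ g : Fin n → CoordRing K V, ∑ i, g i • θ i = x :=
  Submodule.mem_span_range_iff_exists_fun (CoordRing K V)

/-- The coefficients of a homogeneous derivation with respect to a homogeneous independent family
are homogeneous: replacing them by their components of the expected degree does not change the
sum. -/
theorem mem_homogeneousPart_coeff {n : ℕ} {e : Fin n → ℕ} {φ : Fin n → A.logDer}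
    (hli : LinearIndependent (CoordRing K V) φ) (hφ : ∀ i, IsHomogeneousDer (φ i : Der K V) (e i))
    {a : Fin n → CoordRing K V} {N : ℕ}
    (h : IsHomogeneousDer ((∑ j, a j • φ j : A.logDer) : Der K V) N) (j : Fin n) :
    (e j ≤ N → a j ∈ homogeneousPart K V (N - e j)) ∧ (N < e j → a j = 0) := by
  let c : Fin n → CoordRing K V := fun j =>
    if e j ≤ N then (DirectSum.decompose (homogeneousPart K V) (a j) (N - e j) : CoordRing K V)
    else 0
  have hev : ∀ (a : Fin n → CoordRing K V) (α : Module.Dual K V),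
      ((∑ j, a j • φ j : A.logDer) : Der K V) (linForm K V α)
        = ∑ j, a j * (φ j : Der K V) (linForm K V α) := by
    intro a α
    rw [← Submodule.subtype_apply, map_sum, ← Derivation.coeFnAddMonoidHom_apply, map_sum,
      Finset.sum_apply]
    rfl
  have hc : ∑ j, c j • φ j = ∑ j, a j • φ j := by
    refine logDer_ext fun α => ?_
    rw [← DirectSum.decompose_of_mem_same _ (h α), hev, hev, DirectSum.decompose_sum,
      DFinsupp.finsetSum_apply, AddSubmonoidClass.coe_finsetSum]
    refine Finset.sum_congr rfl fun j _ => ?_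
    rw [DirectSum.coe_decompose_mul_of_right_mem _ N (hφ j α)]
    simp only [c]
    split_ifs
    · rfl
    · rw [zero_mul]
  have hca : c j = a j := by
    have h0 : ∑ j, (c j - a j) • φ j = 0 := by
      rw [Finset.sum_congr rfl fun j _ => sub_smul (c j) (a j) (φ j)]
      exact (Finset.sum_sub_distrib (G := A.logDer) _ _).trans (sub_eq_zero.2 hc)
    exact sub_eq_zero.1 (logDer_linearIndependent_iff.1 hli _ h0 j)
  constructor
  · intro hj
    rw [← hca]
    simp only [c, if_pos hj]
    exact SetLike.coe_mem _
  · intro hj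
    rw [← hca]
    simp only [c, if_neg hj.not_ge]

theorem IsHomogeneousBasis.exists_basis {n : ℕ} {d : Fin n → ℕ} {θ : Fin n → A.logDer}
    (h : A.IsHomogeneousBasis d θ) :
    ∃ b : Module.Basis (Fin n) (CoordRing K V) A.logDer, ⇑b = θ :=
  ⟨Module.Basis.mk (R := CoordRing K V) (M := A.logDer) (v := θ) h.1 (le_of_eq h.2.1.symm),
    Module.Basis.coe_mk (R := CoordRing K V) (M := A.logDer) _ _⟩

theorem IsHomogeneousBasis.of_isUnit_det {n : ℕ} {d : Fin n → ℕ} {θ : Fin n → A.logDer}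
    (b : Module.Basis (Fin n) (CoordRing K V) A.logDer) (h : IsUnit (b.det θ))
    (hθ : ∀ i, IsHomogeneousDer (θ i : Der K V) (d i)) : A.IsHomogeneousBasis d θ := by
  have h' := (Module.Basis.is_basis_iff_det (R := CoordRing K V) (M := A.logDer) b).2 h
  exact ⟨h'.1, h'.2, hθ⟩

/-- The coordinate ring has a prime element as soon as it has a nonzero derivation, namely any
nonzero linear form. -/
theorem exists_prime_of_ne_zero {θ : A.logDer} (h : θ ≠ 0) : ∃ p : CoordRing K V, Prime p := by
  by_contra hp
  refine h (logDer_ext fun α => ?_)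
  have : α = 0 := by
    by_contra hα
    exact hp ⟨_, prime_linForm hα⟩
  simp [this]

/-- Exponents are unique: the constant coefficient of the transition determinant is nonzero, so one
of its terms is a product of entries of degree zero. -/
theorem exp_eq_of_isUnit_det {n : ℕ} {e f : Fin n → ℕ} {φ ψ : Fin n → A.logDer}
    (b : Module.Basis (Fin n) (CoordRing K V) A.logDer) (hb : ⇑b = φ)
    (hφ : ∀ i, IsHomogeneousDer (φ i : Der K V) (e i))
    (hψ : ∀ i, IsHomogeneousDer (ψ i : Der K V) (f i)) (he : Monotone e) (hf : Monotone f)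
    (hdet : IsUnit (b.det ψ)) : f = e := by
  have hli : LinearIndependent (CoordRing K V) φ := hb ▸ b.linearIndependent
  have hne : constCoeff (b.det ψ) ≠ 0 := (hdet.map constCoeff).ne_zero
  rw [Module.Basis.det_apply, Matrix.det_apply, map_sum] at hne
  obtain ⟨σ, -, hσ⟩ := Finset.exists_ne_zero_of_sum_ne_zero hne
  have hfe : ∀ i, f i = e (σ i) := by
    intro i
    have hi : constCoeff (b.repr (ψ i) (σ i)) ≠ 0 := by
      intro h0
      apply hσ
      rw [Units.smul_def, map_zsmul, map_prod, Finset.prod_eq_zero (Finset.mem_univ i), smul_zero]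
      exact h0
    have hsum : ∑ j, b.repr (ψ i) j • φ j = ψ i := by rw [← hb, b.sum_repr]
    have hcoef := mem_homogeneousPart_coeff hli hφ (a := fun j => b.repr (ψ i) j) (N := f i)
      (by rw [hsum]; exact hψ i) (σ i)
    rcases lt_trichotomy (f i) (e (σ i)) with h | h | h
    · rw [hcoef.2 h, map_zero] at hi
      exact absurd rfl hi
    · exact h
    · obtain ⟨r, hr⟩ : ∃ r, f i - e (σ i) = r + 1 := ⟨f i - e (σ i) - 1, by omega⟩
      have hm := hcoef.1 h.le
      rw [hr] at hm
      exact absurd (constCoeff_eq_zero hm) hi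
  have hcomp : f = e ∘ σ := funext hfe
  rw [hcomp]
  exact Tuple.unique_monotone (σ := σ) (τ := 1) (hcomp ▸ hf) he

theorem isUnit_logDer_det_of_locally_spanning {n : ℕ}
    (b : Module.Basis (Fin n) (CoordRing K V) A.logDer) (ψ : Fin n → A.logDer)
    (hex : ∃ p : CoordRing K V, Prime p)
    (h : ∀ p : CoordRing K V, Prime p →
      ∃ s, ¬ p ∣ s ∧ ∀ j, s • b j ∈ Submodule.span (CoordRing K V) (Set.range ψ)) :
    IsUnit (b.det ψ) := by
  -- Elaborated without the expected type, which would unfold the ring structure of `Sym(V*)`.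
  have h' := isUnit_det_of_locally_spanning (R := CoordRing K V) (M := A.logDer) b ψ hex
  exact h' h

/-- The case of `D(A)` of `isUnit_det_of_locally_spanning`, with the uniqueness of exponents. -/
theorem IsHomogeneousBasis.of_locally_spanning {m : ℕ} {e f : Fin (m + 1) → ℕ}
    {φ ψ : Fin (m + 1) → A.logDer} (hφ : A.IsHomogeneousBasis e φ)
    (hψ : ∀ i, IsHomogeneousDer (ψ i : Der K V) (f i))
    (h : ∀ p : CoordRing K V, Prime p →
      ∃ s, ¬ p ∣ s ∧ ∀ j, s • φ j ∈ Submodule.span (CoordRing K V) (Set.range ψ)) :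
    A.IsHomogeneousBasis f ψ ∧ (Monotone e → Monotone f → f = e) := by
  have hne : φ 0 ≠ 0 :=
    LinearIndependent.ne_zero (R := CoordRing K V) (M := A.logDer) 0 hφ.1
  have hex := exists_prime_of_ne_zero hne
  obtain ⟨b, rfl⟩ := hφ.exists_basis
  have hdet : IsUnit (b.det ψ) := isUnit_logDer_det_of_locally_spanning b ψ hex h
  exact ⟨.of_isUnit_det b hdet hψ,
    fun he hf => exp_eq_of_isUnit_det b rfl hφ.2.2 hψ he hf hdet⟩

section Restriction

variable {H : Submodule K V} {hH : H ∈ A.hyperplanes}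

/-- Homogeneous derivations in the right number whose span contains the image of the Euler
restriction map form a basis of `D(A^H)`, because this map is surjective in codimension one. -/
theorem isHomogeneousBasis_of_eulerRestriction_mem_span {n m : ℕ} {d : Fin n → ℕ}
    {θ : Fin n → A.logDer} (hθ : A.IsHomogeneousBasis d θ) {e f : Fin (m + 1) → ℕ}
    {φ ψ : Fin (m + 1) → (A.restriction H hH).logDer}
    (hφ : (A.restriction H hH).IsHomogeneousBasis e φ)
    (hψ : ∀ i, IsHomogeneousDer (ψ i : Der K H) (f i))
    (hspan : ∀ i, A.eulerRestriction H hH (θ i) ∈ Submodule.span (CoordRing K H) (Set.range ψ)) :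
    (A.restriction H hH).IsHomogeneousBasis f ψ ∧ (Monotone e → Monotone f → f = e) := by
  have hmem : ∀ η : A.logDer,
      A.eulerRestriction H hH η ∈ Submodule.span (CoordRing K H) (Set.range ψ) := by
    intro η
    have hη : η ∈ Submodule.span (CoordRing K V) (Set.range θ) := by
      rw [hθ.2.1]
      exact Submodule.mem_top
    obtain ⟨c, rfl⟩ := mem_span_range_logDer_iff.1 hη
    rw [eulerRestriction_sum_smul]
    exact Submodule.sum_mem _ fun i _ => Submodule.smul_mem _ _ (hspan i)
  refine hφ.of_locally_spanning hψ fun p hp => ?_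
  obtain ⟨s, hps, hs⟩ := exists_smul_mem_range_eulerRestriction hH hp
  refine ⟨s, hps, fun j => ?_⟩
  obtain ⟨η, hη⟩ := hs (φ j)
  rw [← hη]
  exact hmem η

/-! ### Freeness of the deletion -/

/-- The kernel of the Euler restriction map is `α_H D(A ∖ {H})`. -/
theorem exists_smul_eq_of_eulerRestriction_eq_zero {α : Module.Dual K V} (hα : LinearMap.ker α = H)
    (hα0 : α ≠ 0) {θ : A.logDer} (h : A.eulerRestriction H hH θ = 0) :
    ∃ η : (A.deletion H).logDer, linForm K V α • (η : Der K V) = θ := by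
  choose q hq using linForm_dvd_of_eulerRestriction_eq_zero hH hα h
  have hcancel : ∀ {f g : CoordRing K V}, linForm K V α * f = linForm K V α * g → f = g :=
    fun h => mul_left_cancel₀ (linForm_ne_zero hα0) h
  let η : Der K V := Derivation.mk'
    { toFun := q
      map_add' := fun f g => hcancel (by rw [← hq, mul_add, ← hq, ← hq, map_add])
      map_smul' := fun c f => hcancel (by
        rw [← hq, RingHom.id_apply, mul_smul_comm, ← hq, Derivation.map_smul]) }
    (fun f g => hcancel (by
      change linForm K V α * q (f * g) = linForm K V α * (f * q g + g * q f)
      rw [← hq, Derivation.leibniz, hq, hq, smul_eq_mul, smul_eq_mul]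
      ring))
  have hη : ∀ f, η f = q f := fun f => rfl
  refine ⟨⟨η, ?_⟩, ?_⟩
  · rintro L ⟨hL, hLH⟩ β hβ
    rw [Ideal.mem_span_singleton, hη]
    have h1 := Ideal.mem_span_singleton.1 (θ.2 L hL β hβ)
    rw [hq] at h1
    have hβ0 : β ≠ 0 := by
      rintro rfl
      obtain ⟨γ, hγ0, hγ⟩ := A.exists_form L hL
      rw [← hβ, LinearMap.ker_zero, LinearMap.ker_eq_top] at hγ
      exact hγ0 hγ
    refine ((prime_linForm hβ0).dvd_or_dvd h1).resolve_left fun hdvd => hLH ?_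
    rw [Set.mem_singleton_iff, ← hβ, ← hα]
    apply ker_eq_of_ker_le hα0
    exact res_linForm_eq_zero_iff.1 ((res_eq_zero_iff_dvd rfl).2 hdvd)
  · ext f
    exact (hq f).symm

theorem smul_mem_logDer {α : Module.Dual K V} (hα : LinearMap.ker α = H)
    (x : (A.deletion H).logDer) : linForm K V α • (x : Der K V) ∈ A.logDer := by
  intro L hL β hβ
  rw [Derivation.smul_apply, smul_eq_mul]
  by_cases hLH : L = H
  · obtain ⟨c, rfl⟩ := exists_smul_of_ker_le (α := β) (β := α) (by rw [hα, hβ, hLH])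
    rw [map_smul, smul_mul_assoc]
    exact Submodule.smul_of_tower_mem _ c
      (Ideal.mul_mem_right _ _ (Ideal.mem_span_singleton_self _))
  · exact Ideal.mul_mem_left _ _ (x.2 L ⟨hL, hLH⟩ β hβ)

theorem mem_logDer_deletion (θ : A.logDer) : (θ : Der K V) ∈ (A.deletion H).logDer :=
  fun L hL => θ.2 L hL.1

/-- If one member of a homogeneous basis of `D(A)` restricts to zero and the others restrict to an
independent family, then dividing that member by `α_H` gives a homogeneous basis of
`D(A ∖ {H})`. -/
theorem deletion_isFreeWithExp {n : ℕ} {d : Fin (n + 1) → ℕ}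
    {θ : Fin (n + 1) → A.logDer} (hθ : A.IsHomogeneousBasis d θ) (b : Fin (n + 1))
    (hdb : 1 ≤ d b) (hb : A.eulerRestriction H hH (θ b) = 0)
    (hli : LinearIndependent (CoordRing K H) fun i => A.eulerRestriction H hH (θ (b.succAbove i))) :
    (A.deletion H).IsFreeWithExp (Function.update d b (d b - 1)) := by
  classical
  obtain ⟨α, hα0, hα⟩ := A.exists_form H hH
  obtain ⟨θ', hθ'⟩ := exists_smul_eq_of_eulerRestriction_eq_zero hα hα0 hb
  have hα1 := linForm_ne_zero hα0
  let η : Fin (n + 1) → (A.deletion H).logDer :=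
    Function.update (fun i => ⟨θ i, mem_logDer_deletion (θ i)⟩) b θ'
  have hηb : η b = θ' := Function.update_self ..
  have hηne : ∀ i, i ≠ b → (η i : Der K V) = θ i := fun i hi => by
    simp only [η, Function.update_of_ne hi]
  -- `t i θ_i = α η_i` reduces independence and spanning of `η` to those of `θ`.
  let t : Fin (n + 1) → CoordRing K V := fun i => if i = b then 1 else linForm K V α
  have ht0 : ∀ i, t i ≠ 0 := fun i => by
    simp only [t]; split_ifs
    exacts [one_ne_zero, hα1]
  have ht : ∀ i, t i • (θ i : Der K V) = linForm K V α • (η i : Der K V) := fun i => by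
    by_cases hi : i = b
    · subst hi
      simp only [t, if_true, one_smul, hηb, hθ']
    · simp only [t, if_neg hi, hηne i hi]
  have hsumη : ∀ g : Fin (n + 1) → CoordRing K V,
      ((∑ i, g i • η i : (A.deletion H).logDer) : Der K V) = ∑ i, g i • (η i : Der K V) :=
    fun g => by simp
  have hsumθ : ∀ g : Fin (n + 1) → CoordRing K V,
      ((∑ i, g i • θ i : A.logDer) : Der K V) = ∑ i, g i • (θ i : Der K V) :=
    fun g => by simp
  refine ⟨η, ?_, ?_, ?_⟩
  · rw [logDer_linearIndependent_iff]
    intro g hg i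
    have h0 : ∑ i, (g i * t i) • θ i = 0 := by
      apply Subtype.ext
      rw [hsumθ]
      simp only [mul_smul, ht]
      simp only [smul_comm _ (linForm K V α), ← Finset.smul_sum, ← hsumη, hg]
      simp
    exact (mul_eq_zero.1 (logDer_linearIndependent_iff.1 hθ.1 _ h0 i)).resolve_right (ht0 i)
  · rw [eq_top_iff]
    rintro x -
    have hx : (⟨_, smul_mem_logDer hα x⟩ : A.logDer)
      ∈ Submodule.span (CoordRing K V) (Set.range θ) := hθ.2.1 ▸ Submodule.mem_top
    obtain ⟨h, hh⟩ := mem_span_range_logDer_iff.1 hx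
    have hres : A.eulerRestriction H hH ⟨_, smul_mem_logDer hα x⟩ = 0 := by
      refine logDer_ext fun β => ?_
      obtain ⟨γ, rfl⟩ := LinearMap.dualMap_surjective_of_injective H.injective_subtype β
      rw [← res_linForm, eulerRestriction_res, Derivation.smul_apply, smul_eq_mul, map_mul,
        res_linForm_eq_zero hα, zero_mul]
      rfl
    rw [← hh, eulerRestriction_sum_smul, Fin.sum_univ_succAbove _ b, hb, smul_zero, zero_add]
      at hres
    -- Since `α x` restricts to zero, so do its coefficients other than the one of `θ_b`.
    have hdvd : ∀ i, i ≠ b → linForm K V α ∣ h i := by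
      intro i hi
      obtain ⟨j, rfl⟩ := Fin.exists_succAbove_eq hi
      exact (res_eq_zero_iff_dvd hα).1 (logDer_linearIndependent_iff.1 hli _ hres j)
    have hk : ∀ i, ∃ k : CoordRing K V,
        h i • (θ i : Der K V) = linForm K V α • k • (η i : Der K V) := by
      intro i
      by_cases hi : i = b
      · subst hi
        exact ⟨h i, by rw [hηb, smul_comm, hθ']⟩
      · obtain ⟨k, hk⟩ := hdvd i hi
        exact ⟨k, by rw [hηne i hi, hk, mul_smul]⟩
    choose k hk using hk
    refine mem_span_range_logDer_iff.2 ⟨k, Subtype.ext ?_⟩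
    have h1 := congrArg (Subtype.val) hh
    rw [hsumθ] at h1
    simp only [hk, ← Finset.smul_sum] at h1
    rw [hsumη]
    ext f
    exact mul_left_cancel₀ hα1 (congrArg (fun D : Der K V => D f) h1)
  · intro i
    by_cases hi : i = b
    · subst hi
      rw [Function.update_self, hηb]
      intro β
      apply mem_homogeneousPart_of_mul_mem hα0
      rw [Nat.sub_add_cancel hdb]
      have := hθ.2.2 i β
      rw [← hθ'] at this
      exact this
    · rw [Function.update_of_ne hi, hηne i hi]
      exact hθ.2.2 i

theorem deletion_isFreeWithExp_of_eulerRestriction_eq_zero {m : ℕ} {d : Fin (m + 2) → ℕ}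
    {θ : Fin (m + 2) → A.logDer} (hθ : A.IsHomogeneousBasis d θ) {e : Fin (m + 1) → ℕ}
    (hAH : (A.restriction H hH).IsFreeWithExp e) (b : Fin (m + 2)) (hdb : 1 ≤ d b)
    (hb : A.eulerRestriction H hH (θ b) = 0) :
    (A.deletion H).IsFreeWithExp (Function.update d b (d b - 1)) := by
  obtain ⟨φ, hφ⟩ := hAH
  refine deletion_isFreeWithExp hθ b hdb hb
    (isHomogeneousBasis_of_eulerRestriction_mem_span hθ hφ
      (f := fun i => d (b.succAbove i))
      (fun i => isHomogeneousDer_eulerRestriction hH (hθ.2.2 _)) fun i => ?_).1.1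
  rcases Fin.eq_self_or_eq_succAbove b i with rfl | ⟨j, rfl⟩
  · rw [hb]
    exact Submodule.zero_mem _
  · exact Submodule.subset_span ⟨j, rfl⟩

/-- Adding homogeneous multiples of one member to the others preserves homogeneous bases. -/
theorem IsHomogeneousBasis.add_smul {n : ℕ} {d : Fin n → ℕ} {θ : Fin n → A.logDer}
    (hθ : A.IsHomogeneousBasis d θ) {a : Fin n} {c : Fin n → CoordRing K V} (hca : c a = 0)
    (hc : ∀ i, IsHomogeneousDer ((c i • θ a : A.logDer) : Der K V) (d i)) :
    A.IsHomogeneousBasis d (θ + (c · • θ a)) := by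
  refine ⟨(linearIndependent_add_smul_iff (R := CoordRing K V) (M := A.logDer) hca).2 hθ.1,
    ?_, fun i α => ?_⟩
  · rw [eq_top_iff, ← hθ.2.1, Submodule.span_le]
    rintro _ ⟨i, rfl⟩
    have hmem : ∀ j, θ j + c j • θ a
        ∈ Submodule.span (CoordRing K V) (Set.range (θ + (c · • θ a))) :=
      fun j => Submodule.subset_span ⟨j, rfl⟩
    have ha := hmem a
    rw [hca, zero_smul, add_zero] at ha
    have hsub := Submodule.sub_mem (R := CoordRing K V) (M := A.logDer) _ (hmem i)
      (Submodule.smul_mem _ (c i) ha)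
    exact (add_sub_cancel_right (G := A.logDer) (θ i) (c i • θ a)) ▸ hsub
  · exact Submodule.add_mem _ (hθ.2.2 i α) (hc i α)

/-! ### Comparison of the exponents -/

/-- If `d_k < e_k`, then for degree reasons the restrictions of `θ_0, …, θ_k` only involve
`φ_0, …, φ_{k-1}`. -/
theorem eulerRestriction_eq_sum_lt {m : ℕ} {d : Fin (m + 2) → ℕ} {e : Fin (m + 1) → ℕ}
    (hd : Monotone d) (he : Monotone e) {θ : Fin (m + 2) → A.logDer}
    (hθ : A.IsHomogeneousBasis d θ) {φ : Fin (m + 1) → (A.restriction H hH).logDer}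
    (hφ : (A.restriction H hH).IsHomogeneousBasis e φ) {k : Fin (m + 1)}
    (hk : d k.castSucc < e k) {i : Fin (m + 2)} (hi : i ≤ k.castSucc) :
    ∃ P : Fin (m + 1) → CoordRing K H, A.eulerRestriction H hH (θ i) = ∑ j, P j • φ j ∧
      (∀ j, k ≤ j → P j = 0) ∧ ∀ j, e j ≤ d i → P j ∈ homogeneousPart K H (d i - e j) := by
  have hmem : A.eulerRestriction H hH (θ i) ∈ Submodule.span (CoordRing K H) (Set.range φ) :=
    hφ.2.1 ▸ Submodule.mem_top
  obtain ⟨P, hP⟩ := mem_span_range_logDer_iff.1 hmem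
  have hcoef := mem_homogeneousPart_coeff hφ.1 hφ.2.2 (a := P) (N := d i)
    (by rw [hP]; exact isHomogeneousDer_eulerRestriction hH (hθ.2.2 i))
  exact ⟨P, hP.symm, fun j hj => (hcoef j).2 ((hd hi).trans_lt (hk.trans_le (he hj))),
    fun j => (hcoef j).1⟩

/-- If `d_1 < e_1`, then the deletion is free: a homogeneous combination of `θ_0` and `θ_1` that
can replace one of them in the basis restricts to zero. -/
theorem exists_deletion_isFreeWithExp {m : ℕ} {d : Fin (m + 2) → ℕ} {e : Fin (m + 1) → ℕ}
    (hd_one : d 0 = 1) (hd : Monotone d) (he_one : e 0 = 1) (he : Monotone e)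
    (hA : A.IsFreeWithExp d) (hAH : (A.restriction H hH).IsFreeWithExp e)
    {k : Fin (m + 1)} (hk1 : (k : ℕ) = 1) (hk : d k.castSucc < e k) :
    ∃ d' : Fin (m + 2) → ℕ, (A.deletion H).IsFreeWithExp d' := by
  obtain ⟨θ, hθ⟩ := hA
  obtain ⟨φ, hφ⟩ := id hAH
  have hd_pos : ∀ i, 1 ≤ d i := fun i => hd_one ▸ hd (Fin.zero_le i)
  obtain ⟨P, hP, hP0, hPh⟩ := eulerRestriction_eq_sum_lt hd he hθ hφ hk (Fin.zero_le _)
  have hone : (1 : Fin (m + 2)) ≤ k.castSucc := by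
    rw [Fin.le_def, Fin.val_castSucc, hk1, Fin.val_one]
  obtain ⟨Q, hQ, hQ0, hQh⟩ := eulerRestriction_eq_sum_lt hd he hθ hφ hk hone
  have hne : ∀ j : Fin (m + 1), j ≠ 0 → k ≤ j := fun j hj => by
    rw [Fin.le_def, hk1]
    exact Nat.one_le_iff_ne_zero.2 (Fin.val_ne_zero_iff.2 hj)
  rw [Fintype.sum_eq_single 0 (fun j hj => by rw [hP0 j (hne j hj), zero_smul])] at hP
  rw [Fintype.sum_eq_single 0 (fun j hj => by rw [hQ0 j (hne j hj), zero_smul])] at hQ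
  have hP1 := hPh 0 (by rw [he_one, hd_one])
  rw [hd_one, he_one, homogeneousPart, Nat.sub_self, pow_zero, Submodule.mem_one] at hP1
  obtain ⟨c, hc⟩ := hP1
  -- If `c = 0`, then `θ_0` restricts to zero; otherwise `θ_1 - u θ_0` does, with `u|_H = c⁻¹ Q_0`.
  by_cases hc0 : c = 0
  · refine ⟨_, deletion_isFreeWithExp_of_eulerRestriction_eq_zero (hH := hH) hθ hAH 0 (hd_pos 0) ?_⟩
    rw [hP, ← hc, hc0, map_zero, zero_smul]
  · have hQ1 := Submodule.smul_mem _ c⁻¹ (hQh 0 (by rw [he_one]; exact hd_pos 1))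
    rw [he_one, ← map_res_homogeneousPart] at hQ1
    obtain ⟨u, hu, hu'⟩ := hQ1
    have hu'' : res H u = c⁻¹ • Q 0 := hu'
    have hθ' := hθ.add_smul (a := 0) (c := Pi.single 1 (-u))
      (Pi.single_eq_of_ne (by simp) _) (fun i α => by
        by_cases hi : i = 1
        · subst hi
          have hm := mul_mem_homogeneousPart (Submodule.neg_mem _ hu) (hθ.2.2 0 α)
          rw [hd_one, Nat.sub_add_cancel (hd_pos 1)] at hm
          rw [Pi.single_eq_same]
          exact hm
        · rw [Pi.single_eq_of_ne hi, zero_smul]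
          exact Submodule.zero_mem _)
    refine ⟨_, deletion_isFreeWithExp_of_eulerRestriction_eq_zero (hH := hH) hθ' hAH 1
      (hd_pos 1) ?_⟩
    have hcoef : Q 0 + -(c⁻¹ • Q 0) * algebraMap K (CoordRing K H) c = 0 := by
      rw [mul_comm, ← Algebra.smul_def, smul_neg, smul_smul, mul_inv_cancel₀ hc0, one_smul,
        add_neg_cancel]
    rw [Pi.add_apply, Pi.single_eq_same, eulerRestriction_add, eulerRestriction_smul, map_neg, hu'',
      hP, hQ, ← hc, ← mul_smul, ← add_smul, hcoef, zero_smul]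

/-- At the first index `k` with `d_k < e_k`, the derivations
`φ_0, …, φ_{k-1}, ρ(θ_{k+1}), …, ρ(θ_{ℓ-1})` form a homogeneous basis of `D(A^H)` with the same
exponents. -/
theorem exp_eq_and_isHomogeneousBasis_ite {m : ℕ} {d : Fin (m + 2) → ℕ} {e : Fin (m + 1) → ℕ}
    (hd : Monotone d) (he : Monotone e) {k : Fin (m + 1)} (hk : d k.castSucc < e k)
    (hlt : ∀ j, j < k → e j ≤ d j.castSucc) {θ : Fin (m + 2) → A.logDer}
    (hθ : A.IsHomogeneousBasis d θ) {φ : Fin (m + 1) → (A.restriction H hH).logDer}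
    (hφ : (A.restriction H hH).IsHomogeneousBasis e φ) :
    (∀ i, k ≤ i → e i = d i.succ) ∧ (A.restriction H hH).IsHomogeneousBasis e
      fun i => if i < k then φ i else A.eulerRestriction H hH (θ i.succ) := by
  set ψ : Fin (m + 1) → (A.restriction H hH).logDer :=
    fun i => if i < k then φ i else A.eulerRestriction H hH (θ i.succ) with hψ
  -- The degrees of `ψ`; they increase across `k` because `e_j ≤ d_j` for `j < k`.
  let f : Fin (m + 1) → ℕ := fun i => if i < k then e i else d i.succ
  have hspan : ∀ i, A.eulerRestriction H hH (θ i)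
      ∈ Submodule.span (CoordRing K H) (Set.range ψ) := by
    intro i
    by_cases hi : i ≤ k.castSucc
    · obtain ⟨P, hP, hP0, -⟩ := eulerRestriction_eq_sum_lt hd he hθ hφ hk hi
      rw [hP]
      refine Submodule.sum_mem _ fun j _ => ?_
      by_cases hj : j < k
      · exact Submodule.smul_mem _ _ (Submodule.subset_span ⟨j, if_pos hj⟩)
      · rw [hP0 j (not_lt.1 hj), zero_smul]
        exact Submodule.zero_mem _
    · obtain ⟨j, rfl⟩ := Fin.exists_succ_eq.2 (show i ≠ 0 by rintro rfl; exact hi (Fin.zero_le _))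
      have hj : ¬ j < k := fun hj => hi (Fin.succ_le_castSucc_iff.2 hj)
      exact Submodule.subset_span ⟨j, if_neg hj⟩
  have hfmono : Monotone f := by
    intro i j hij
    simp only [f]
    split_ifs with h1 h2 h2
    · exact he hij
    · refine (hlt i h1).trans (hd ?_)
      exact (Fin.castSucc_le_castSucc_iff.2 hij).trans (Fin.castSucc_le_succ j)
    · exact absurd (hij.trans_lt h2) h1
    · exact hd (Fin.succ_le_succ_iff.2 hij)
  obtain ⟨hbasis, hfe⟩ := isHomogeneousBasis_of_eulerRestriction_mem_span hθ hφ (f := f) (ψ := ψ)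
    (fun i => by
      simp only [f, hψ]
      split_ifs
      · exact hφ.2.2 i
      · exact isHomogeneousDer_eulerRestriction hH (hθ.2.2 _)) hspan
  have hfe' := hfe he hfmono
  refine ⟨fun i hi => ?_, hfe' ▸ hbasis⟩
  rw [← hfe']
  exact if_neg hi.not_gt

end Restriction

end Arrangement

end HypArr

end

theorem theorem5p4 {K : Type*} [Field K] {V : Type*} [AddCommGroup V] [Module K V]
    [FiniteDimensional K V] (m : ℕ) (hV : Module.finrank K V = m + 2)
    (A : HypArr.Arrangement K V) (H : Submodule K V) (hH : H ∈ A.hyperplanes)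
    (d : Fin (m + 2) → ℕ) (e : Fin (m + 1) → ℕ)
    (hd_one : d 0 = 1) (hd_mono : Monotone d) (hA : A.IsFreeWithExp d)
    (he_one : e 0 = 1) (he_mono : Monotone e) (hAH : (A.restriction H hH).IsFreeWithExp e)
    (hA' : ¬ (A.deletion H).IsFree) :
    (∀ j : Fin (m + 1), e j ≤ d j.castSucc) ∨
    ∃ k : Fin (m + 1), 2 ≤ (k : ℕ) ∧
      (∀ j : Fin (m + 1), j < k → e j ≤ d j.castSucc) ∧
      d k.castSucc < e k ∧
      (∀ i : Fin (m + 1), k ≤ i → e i = d i.succ) ∧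
      ∀ (θ : Fin (m + 2) → A.logDer) (φ : Fin (m + 1) → (A.restriction H hH).logDer),
        A.IsHomogeneousBasis d θ → (A.restriction H hH).IsHomogeneousBasis e φ →
        ∃ ψ : Fin (m + 1) → (A.restriction H hH).logDer,
          (A.restriction H hH).IsHomogeneousBasis e ψ ∧
          (∀ i : Fin (m + 1), i < k → ψ i = φ i) ∧
          ∀ i : Fin (m + 1), k ≤ i → ψ i = A.eulerRestriction H hH (θ i.succ) := by
  by_cases hex : ∃ k : Fin (m + 1), d k.castSucc < e k
  swap
  · push Not at hex
    exact Or.inl hex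
  right
  let k := Fin.find (fun k : Fin (m + 1) => d k.castSucc < e k) hex
  have hk : d k.castSucc < e k := Fin.find_spec hex
  have hlt : ∀ j : Fin (m + 1), j < k → e j ≤ d j.castSucc :=
    fun j hj => not_lt.1 (Fin.find_min hex hj)
  have hk2 : 2 ≤ (k : ℕ) := by
    by_contra hk2
    have hk01 : (k : ℕ) = 0 ∨ (k : ℕ) = 1 := by omega
    rcases hk01 with h0 | h1
    · rw [Fin.val_eq_zero_iff.1 h0, Fin.castSucc_zero, hd_one, he_one] at hk
      exact lt_irrefl _ hk
    · apply hA'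
      unfold HypArr.Arrangement.IsFree
      rw [hV]
      exact HypArr.Arrangement.exists_deletion_isFreeWithExp hd_one hd_mono he_one he_mono hA hAH
        h1 hk
  refine ⟨k, hk2, hlt, hk, ?_, fun θ φ hθ hφ => ⟨_,
    (HypArr.Arrangement.exp_eq_and_isHomogeneousBasis_ite hd_mono he_mono hk hlt hθ hφ).2,
    fun i hi => if_pos hi, fun i hi => if_neg hi.not_gt⟩⟩
  obtain ⟨θ, hθ⟩ := hA
  obtain ⟨φ, hφ⟩ := hAH
  exact (HypArr.Arrangement.exp_eq_and_isHomogeneousBasis_ite hd_mono he_mono hk hlt hθ hφ).1
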